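/- **Setting.** Algebras are nonempty. Let $M$ be a finite algebra of finite type (finitely many operation symbols) and let $\mathcal A=\mathbb{ISP}(M)$ be the class of algebras isomorphic to a subalgebra of a (possibly empty) power of $M$. Let $\tilde M=\langle M, G\cup H\cup R,\iota\rangle$, where $\iota$ is the discrete topology, $G$ is a set of homomorphisms $M^n\to M$ ($n\ge 0$; those with $n=0$ are the constants), $H$ is a set of partial operations of arity $n\ge 1$ which are homomorphisms from a nonempty subalgebra of $M^n$ to $M$, and $R$ is a set of nonempty subalgebras of powers $M^n$, $n\ge 1$. Let $\mathcal X$ be the class of topological structures isomorphic to a closed substructure of a power $\tilde M^S$, $S\neq\emptyset$ (the empty substructure being allowed when $G$ contains no constant), with the continuous structure preserving maps as morphisms. For $A\in\mathcal A$ let $A^*$ be the set of homomorphisms $A\to M$, with the structure and topology inherited from $\tilde M^A$; for $X\in\mathcal X$ let $X_*=\mathcal X(X,\tilde M)$, with the pointwise operations of $M$. The structure $\tilde M$ *yields a duality* for $\mathcal A$ if for every $A\in\mathcal A$ the evaluation map $A\to (A^*)_*$ is an isomorphism; the duality is *full* if moreover for every $X\in\mathcal X$ the evaluation map $X\to (X_*)^*$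 is an isomorphism of topological structures; it is *strong* if it is full and $\tilde M$ is injective in $\mathcal X$ (for every embedding $X\to Y$ onto a closed substructure, with $X,Y\in\mathcal X$, every morphism $X\to\tilde M$ extends to $Y$). A strong duality is *logarithmic* if for all $X,Y\in\mathcal X$ the coproduct of $X$ and $Y$ in $\mathcal X$ is realized as their direct union, that is, the disjoint union of $X$ and $Y$ with the constants amalgamated (with the union topology, and with each relation and the graph of each total or partial operation being the union of those of $X$ and $Y$). The *natural extension* $A^\delta$ of $A\in\mathcal A$ is the topological closure of $\{e_A(a)\mid a\in A\}$ in the power $M^{A^*}$ of the discrete algebra $M$, where $e_A(a)(\phi)=\phi(a)$; it is a topological algebra for the induced topology and the pointwise operations. For $a\in A$ and $m\in M$ let $[a:m]=\{\psi\in A^*\mid \psi(a)=m\}$. An algebra $A$ is a *Boolean product* of a family $(A_i)_{i\in I}$ if, up to isomorphism, $A$ is a subalgebra of $\prod_{i\in I}A_i$ all of whose projections $A\to A_i$ are onto, and there is a Boolean (compact Hausdorff totally disconnected) topology on $I$ such that $\{i\mid a_i=b_i\}$ is clopen for all $a,b\in A$, and for all $a,b\in A$ and all clopen $N\subseteq I$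 the element equal to $a$ on $N$ and to $b$ on $I\setminus N$ belongs to $A$. **Theorem.** Assume that $\tilde M$ yields a logarithmic duality for $\mathcal A$. Let $A$ be a Boolean product of a family $(A_i)_{i\in I}$ of algebras of $\mathcal A$. Assume that for every $n\ge 1$ and all $m_1,\dots,m_n\in M$ there is an open (that is, quantifier-free) formula $\phi(x_1,\dots,x_n)$ in the language of $M$ such that for every $i\in I$ and all $a_1,\dots,a_n\in A_i$, $$A_i^*=\bigcup_{\lambda=1}^n[a_\lambda:m_\lambda]\iff A_i\models\phi(a_1,\dots,a_n).$$ Then there is an isomorphism of algebras $A^\delta\to\prod_{i\in I}A_i^\delta$ that is also a homeomorphism, where the product carries the pointwise operations and the product topology. -/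

import Mathlib

open FirstOrder FirstOrder.Language

universe u v w u₁ u₂

namespace NatExt

/-! ### Products of algebras -/

/-- The product of a family of structures, with pointwise operations (and relations). -/
instance piStructure {L : FirstOrder.Language.{u₁, u₂}} {ι : Type v} {B : ι → Type w}
    [∀ i, L.Structure (B i)] : L.Structure (∀ i, B i) where
  funMap f x := fun i => Structure.funMap f (fun l => x l i)
  RelMap r x := ∀ i, Structure.RelMap r (fun l => x l i)

/-! ### Structures with total operations, partial operations and relations -/

/-- A type of structures: symbols for total operations (arity `0` gives the constants), for
partial operations and for relations, the last two of positive arity. -/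
structure StrType where
  Op : Type w
  POp : Type w
  Rel : Type w
  arOp : Op → ℕ
  arPOp : POp → ℕ
  arRel : Rel → ℕ
  arPOp_pos : ∀ h, 0 < arPOp h
  arRel_pos : ∀ r, 0 < arRel r

/-- A topological structure of type `τ`: a topological space with operations, partial operations
`pop h` with domain `dom h`, and relations. -/
structure TopStr (τ : StrType.{w}) where
  carrier : Type u
  [top : TopologicalSpace carrier]
  op : ∀ g : τ.Op, (Fin (τ.arOp g) → carrier) → carrier
  dom : ∀ h : τ.POp, Set (Fin (τ.arPOp h) → carrier)
  pop : ∀ (h : τ.POp) (x : Fin (τ.arPOp h) → carrier), x ∈ dom h → carrier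
  rel : ∀ r : τ.Rel, Set (Fin (τ.arRel r) → carrier)

namespace TopStr

variable {τ : StrType.{w}}

instance : CoeSort (TopStr.{u} τ) (Type u) := ⟨TopStr.carrier⟩

instance (X : TopStr.{u} τ) : TopologicalSpace X := X.top

/-- Continuous structure preserving maps. -/
structure IsMor (X Y : TopStr.{u} τ) (f : X → Y) : Prop where
  continuous : Continuous f
  map_op : ∀ g x, f (X.op g x) = Y.op g (f ∘ x)
  map_dom : ∀ h x, x ∈ X.dom h → f ∘ x ∈ Y.dom h
  map_pop : ∀ h x (hx : x ∈ X.dom h), f (X.pop h x hx) = Y.pop h (f ∘ x) (map_dom h x hx)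
  map_rel : ∀ r x, x ∈ X.rel r → f ∘ x ∈ Y.rel r

/-- Embeddings: isomorphisms (of topological structures) onto a closed substructure, where
domains of partial operations and relations are restricted to the substructure. -/
structure IsEmb (X Y : TopStr.{u} τ) (f : X → Y) : Prop extends IsMor X Y f where
  isClosedEmbedding : Topology.IsClosedEmbedding f
  mem_dom : ∀ h x, f ∘ x ∈ Y.dom h → x ∈ X.dom h
  mem_rel : ∀ r x, f ∘ x ∈ Y.rel r → x ∈ X.rel r

/-- The set of continuous structure preserving maps. -/
def Mor (X Y : TopStr.{u} τ) : Type u := {f : X → Y // IsMor X Y f}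

/-- The power `M ^ S`, with pointwise structure and product topology. -/
def pow (M : TopStr.{u} τ) (S : Type u) : TopStr.{u} τ where
  carrier := S → M
  op g x := fun s => M.op g (fun l => x l s)
  dom h := {x | ∀ s, (fun l => x l s) ∈ M.dom h}
  pop h x hx := fun s => M.pop h (fun l => x l s) (hx s)
  rel r := {x | ∀ s, (fun l => x l s) ∈ M.rel r}

/-- `X` belongs to the topological prevariety generated by `M`: it is isomorphic to a closed
substructure of a nonempty power of `M`. -/
def InPrevariety (M X : TopStr.{u} τ) : Prop :=
  ∃ S : Type u, Nonempty S ∧ ∃ k : X → M.pow S, IsEmb X (M.pow S) k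

/-- `M` is injective in the topological prevariety that it generates. -/
def IsInjective (M : TopStr.{u} τ) : Prop :=
  ∀ X Y : TopStr.{u} τ, InPrevariety M X → InPrevariety M Y →
    ∀ k : X → Y, IsEmb X Y k → ∀ x : X → M, IsMor X M x →
      ∃ y : Y → M, IsMor Y M y ∧ ∀ p, y (k p) = x p

/-- `X → Z ← Y` (the maps being `i` and `j`) is a coproduct in the topological prevariety
generated by `M`. -/
structure IsCoproduct (M X Y Z : TopStr.{u} τ) (i : X → Z) (j : Y → Z) : Prop where
  mem : InPrevariety M Z
  mor_left : IsMor X Z i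
  mor_right : IsMor Y Z j
  existsUnique : ∀ W : TopStr.{u} τ, InPrevariety M W →
    ∀ (p : X → W) (q : Y → W), IsMor X W p → IsMor Y W q →
      ∃! r : Z → W, IsMor Z W r ∧ (∀ x, r (i x) = p x) ∧ (∀ y, r (j y) = q y)

/-- `Z` is the direct union of `X` and `Y` (with inclusions `i`, `j`): the disjoint union, with
the constants (values of nullary operations) amalgamated, and with the union structure. -/
structure IsDirectUnion (X Y Z : TopStr.{u} τ) (i : X → Z) (j : Y → Z) : Prop where
  mor_left : IsMor X Z i
  mor_right : IsMor Y Z j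
  injective_left : Function.Injective i
  injective_right : Function.Injective j
  cover : ∀ z, (∃ x, i x = z) ∨ (∃ y, j y = z)
  amalgam : ∀ x y, i x = j y ↔
    ∃ g, τ.arOp g = 0 ∧ (∃ a, x = X.op g a) ∧ (∃ b, y = Y.op g b)
  isOpen_iff : ∀ V : Set Z, IsOpen V ↔ IsOpen (i ⁻¹' V) ∧ IsOpen (j ⁻¹' V)
  cover_op : ∀ (g : τ.Op) (z : Fin (τ.arOp g) → Z), (∃ x, i ∘ x = z) ∨ (∃ y, j ∘ y = z)
  dom_iff : ∀ h z, z ∈ Z.dom h ↔ (∃ x ∈ X.dom h, i ∘ x = z) ∨ (∃ y ∈ Y.dom h, j ∘ y = z)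
  rel_iff : ∀ r z, z ∈ Z.rel r ↔ (∃ x ∈ X.rel r, i ∘ x = z) ∨ (∃ y ∈ Y.rel r, j ∘ y = z)

end TopStr

open TopStr

/-! ### Algebras, alter egos and dualities -/

section Algebra

variable {L : FirstOrder.Language.{u₁, u₂}} [L.IsAlgebraic] {M : Type u} [L.Structure M]

variable (L M) in
/-- `A` is a (nonempty) algebra in the prevariety generated by `M`: it is isomorphic to a
subalgebra of a power of `M`. -/
def InISP (A : Type u) [L.Structure A] : Prop :=
  Nonempty A ∧ ∃ S : Type u, Nonempty (A ↪[L] (S → M))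

variable (L M) in
/-- A structure on the set `M`, with the discrete topology, whose operations, partial operations
(with nonempty domain) and nonempty relations are algebraic over the algebra `M`: total operations
are homomorphisms from powers of `M`, domains and relations are subalgebras of powers of `M`, and
partial operations are homomorphisms on their domain. -/
structure AlterEgo where
  τ : StrType.{w}
  op : ∀ g : τ.Op, (Fin (τ.arOp g) → M) → M
  dom : ∀ h : τ.POp, Set (Fin (τ.arPOp h) → M)
  pop : ∀ (h : τ.POp) (x : Fin (τ.arPOp h) → M), x ∈ dom h → M
  rel : ∀ r : τ.Rel, Set (Fin (τ.arRel r) → M)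
  op_hom : ∀ g {n} (f : L.Functions n) (x : Fin n → Fin (τ.arOp g) → M),
    op g (Structure.funMap f x) = Structure.funMap f (fun l => op g (x l))
  dom_nonempty : ∀ h, (dom h).Nonempty
  dom_closed : ∀ h {n} (f : L.Functions n) (x : Fin n → Fin (τ.arPOp h) → M),
    (∀ l, x l ∈ dom h) → Structure.funMap f x ∈ dom h
  pop_hom : ∀ h {n} (f : L.Functions n) (x : Fin n → Fin (τ.arPOp h) → M)
    (hx : ∀ l, x l ∈ dom h), pop h (Structure.funMap f x) (dom_closed h f x hx) =
      Structure.funMap f (fun l => pop h (x l) (hx l))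
  rel_nonempty : ∀ r, (rel r).Nonempty
  rel_closed : ∀ r {n} (f : L.Functions n) (x : Fin n → Fin (τ.arRel r) → M),
    (∀ l, x l ∈ rel r) → Structure.funMap f x ∈ rel r

namespace AlterEgo

/-- The topological structure on `M` (with the discrete topology). -/
def str (E : AlterEgo.{u, w} L M) : TopStr.{u} E.τ where
  carrier := M
  top := ⊥
  op := E.op
  dom := E.dom
  pop := E.pop
  rel := E.rel

instance (E : AlterEgo.{u, w} L M) : DiscreteTopology E.str := ⟨rfl⟩

instance (E : AlterEgo.{u, w} L M) : L.Structure E.str := inferInstanceAs (L.Structure M)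

/-- The dual of an algebra `A`: the set of homomorphisms from `A` to `M`, with the structure and
the topology inherited from the power of the structure on `M`. -/
def dual (E : AlterEgo.{u, w} L M) (A : Type u) [L.Structure A] : TopStr.{u} E.τ where
  carrier := A →[L] M
  top := TopologicalSpace.induced (fun φ : A →[L] M => ((fun a => φ a) : A → E.str))
    (inferInstanceAs (TopologicalSpace (A → E.str)))
  op g φ :=
    { toFun := fun a => E.op g (fun l => φ l a)
      map_fun' := by
        intro n f x
        rw [show (fun l => φ l (Structure.funMap f x)) =
          Structure.funMap f (fun k l => φ l (x k)) from
            funext fun l => (φ l).map_fun f x, E.op_hom]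
        rfl
      map_rel' := fun r => isEmptyElim r }
  dom h := {φ | ∀ a, (fun l => φ l a) ∈ E.dom h}
  pop h φ hφ :=
    { toFun := fun a => E.pop h (fun l => φ l a) (hφ a)
      map_fun' := by
        intro n f x
        have e : (fun l => φ l (Structure.funMap f x)) =
          Structure.funMap f (fun k l => φ l (x k)) := funext fun l => (φ l).map_fun f x
        have := E.pop_hom h f (fun k l => φ l (x k)) (fun k => hφ (x k))
        simp only [e]
        rw [this]
        rfl
      map_rel' := fun r => isEmptyElim r }
  rel r := {φ | ∀ a, (fun l => φ l a) ∈ E.rel r}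

/-- The dual algebra of a structure `X`: the continuous structure preserving maps from `X` to the
structure on `M`, with pointwise operations. -/
instance dualAlgebra (E : AlterEgo.{u, w} L M) (X : TopStr.{u} E.τ) :
    L.Structure (Mor X E.str) where
  funMap {n} f x := ⟨fun p => Structure.funMap f (fun l => (x l).1 p),
    { continuous := (continuous_of_discreteTopology (α := Fin n → E.str)
          (f := fun y => Structure.funMap f y)).comp
          (continuous_pi fun l => (x l).2.continuous)
      map_op := fun g y => by
        simp only [(x _).2.map_op]
        exact (E.op_hom g f _).symm
      map_dom := fun h y hy => E.dom_closed h f (fun l => (x l).1 ∘ y)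
        (fun l => (x l).2.map_dom h y hy)
      map_pop := fun h y hy => by
        simp only [(x _).2.map_pop h y hy]
        exact (E.pop_hom h f _ (fun l => (x l).2.map_dom h y hy)).symm
      map_rel := fun r y hy => E.rel_closed r f (fun l => (x l).1 ∘ y)
        (fun l => (x l).2.map_rel r y hy) }⟩
  RelMap r := isEmptyElim r

/-- The evaluation map from an algebra to its double dual. -/
def evalAlg (E : AlterEgo.{u, w} L M) (A : Type u) [L.Structure A] :
    A →[L] Mor (E.dual A) E.str where
  toFun a := ⟨fun φ => Hom.toFun φ a,
    { continuous := (continuous_apply (A := fun _ : A => E.str) a).comp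
        (continuous_induced_dom (f := fun φ : A →[L] M => ((fun a => φ a) : A → E.str)))
      map_op := fun _ _ => rfl
      map_dom := fun _ _ hx => hx a
      map_pop := fun _ _ _ => rfl
      map_rel := fun _ _ hx => hx a }⟩
  map_fun' f x := Subtype.ext (funext fun φ => Hom.map_fun (φ : A →[L] M) f x)
  map_rel' r := isEmptyElim r

/-- The evaluation map from a structure to its double dual. -/
def evalStr (E : AlterEgo.{u, w} L M) (X : TopStr.{u} E.τ) (p : X) :
    E.dual (Mor X E.str) :=
  ({ toFun := fun x => x.1 p
     map_fun' := fun _ _ => rfl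
     map_rel' := fun r => isEmptyElim r } : Mor X E.str →[L] M)

/-- The structure yields a duality: every algebra `A` of the prevariety generated by `M` is
isomorphic to its double dual by evaluation. -/
def YieldsDuality (E : AlterEgo.{u, w} L M) : Prop :=
  ∀ (A : Type u) [L.Structure A], InISP L M A → Function.Bijective (E.evalAlg A)

/-- The structure yields a full duality: moreover, every structure in the topological prevariety
is isomorphic to its double dual by evaluation. -/
def YieldsFullDuality (E : AlterEgo.{u, w} L M) : Prop :=
  E.YieldsDuality ∧ ∀ X : TopStr.{u} E.τ, InPrevariety E.str X →
    IsEmb X (E.dual (Mor X E.str)) (E.evalStr X) ∧ Function.Surjective (E.evalStr X)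

/-- The structure yields a strong duality: a full duality for which the structure on `M` is
injective in the topological prevariety that it generates. -/
def YieldsStrongDuality (E : AlterEgo.{u, w} L M) : Prop :=
  E.YieldsFullDuality ∧ E.str.IsInjective

/-- The structure yields a logarithmic duality: a strong duality for which coproducts in the dual
category are realized as direct unions. -/
def YieldsLogarithmicDuality (E : AlterEgo.{u, w} L M) : Prop :=
  E.YieldsStrongDuality ∧ ∀ X Y : TopStr.{u} E.τ,
    InPrevariety E.str X → InPrevariety E.str Y →
      ∃ (Z : TopStr.{u} E.τ) (i : X → Z) (j : Y → Z),
        IsCoproduct E.str X Y Z i j ∧ IsDirectUnion X Y Z i j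

end AlterEgo

/-! ### Natural extensions, Boolean products -/

/-- The set `[a : m]` of the homomorphisms `ψ : A → M` such that `ψ a = m`. -/
def bracket {A : Type u} [L.Structure A] (a : A) (m : M) : Set (A →[L] M) := {ψ | ψ a = m}

variable (L M) in
/-- The natural extension of `A`: the closure of the set of evaluations `e(a) : φ ↦ φ a` in the
power of the discrete algebra `M` indexed by the set of homomorphisms from `A` to `M`. -/
def natExt [TopologicalSpace M] [DiscreteTopology M] (A : Type u) [L.Structure A] :
    L.Substructure ((A →[L] M) → M) where
  carrier := closure (Set.range fun (a : A) (φ : A →[L] M) => φ a)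
  fun_mem {n} f x hx := by
    have hx' : x ∈ closure (Set.univ.pi fun _ : Fin n =>
        Set.range fun (a : A) (φ : A →[L] M) => φ a) := by
      rw [closure_pi_set]
      exact fun l _ => hx l
    refine map_mem_closure (f := fun y : Fin n → (A →[L] M) → M => Structure.funMap f y) ?_ hx' ?_
    · refine continuous_pi fun φ => ?_
      exact (continuous_of_discreteTopology (α := Fin n → M)
        (f := fun y => Structure.funMap f y)).comp
          (continuous_pi fun l => (continuous_apply φ).comp (continuous_apply l))
    · intro y hy
      choose a ha using fun l => hy l (Set.mem_univ l)
      refine ⟨Structure.funMap f a, funext fun φ => ?_⟩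
      change φ (Structure.funMap f a) = _
      rw [Hom.map_fun]
      change Structure.funMap f (φ ∘ a) = Structure.funMap f (fun l => y l φ)
      congr 1
      funext l
      exact congrFun (ha l) φ

variable (L) in
/-- `A` is a Boolean product of the family `B`: up to isomorphism, `A` is a subdirect product of
the family, and for some Boolean topology on the index set, equalizers of elements of `A` are
clopen and elements of `A` can be patched along clopen sets. -/
def IsBooleanProduct {I : Type v} (A : Type u) [L.Structure A] (B : I → Type u)
    [∀ i, L.Structure (B i)] : Prop :=
  ∃ (_ : TopologicalSpace I) (f : A ↪[L] (∀ i, B i)),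
    CompactSpace I ∧ T2Space I ∧ TotallyDisconnectedSpace I ∧
    (∀ i, Function.Surjective fun a => f a i) ∧
    (∀ a b, IsClopen {i | f a i = f b i}) ∧
    (∀ (a b : A) (N : Set I), IsClopen N →
      ∃ c : A, (∀ i ∈ N, f c i = f a i) ∧ (∀ i ∉ N, f c i = f b i))

end Algebra

end NatExt

namespace NatExt

namespace TopStr

variable {τ : StrType.{w}}

/-! A homomorphism `φ : A → M` sees only one coordinate of the Boolean product. If `A` splits into
two factors, their duals have a coproduct `Z` whose dual algebra maps onto `A`; by fullness `φ`
becomes evaluation at a point of `Z`, and in a direct union that point comes from one of the two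
duals (`hom_factors`). A clopen set of indices splits `A` by patching, so compactness localizes a
nonconstant `φ` at a single index (`const_or_factors_proj`).

Hence `A^*` consists of the `B i`-duals glued along constant maps. Restriction to each piece gives a
continuous homomorphism from `A^δ` to the product. It is injective because the pieces and the
constants exhaust `A^*`, and surjective because finitely many local conditions can be met by one
element of `A` (`exists_interpolation`). Compactness does the rest. -/

theorem inPrevariety_self (M : TopStr.{u} τ) : InPrevariety M M := by
  refine ⟨PUnit, inferInstance, fun m _ => m, ?_⟩
  exact
    { continuous := continuous_pi fun _ => continuous_id
      map_op := fun _ _ => rfl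
      map_dom := fun _ _ hx _ => hx
      map_pop := fun _ _ _ => rfl
      map_rel := fun _ _ hx _ => hx
      isClosedEmbedding := (Homeomorph.funUnique PUnit M).symm.isClosedEmbedding
      mem_dom := fun _ _ hx => hx PUnit.unit
      mem_rel := fun _ _ hx => hx PUnit.unit }

end TopStr

open TopStr

/-! ### Homomorphisms on an algebra split into two factors -/

section Duality

variable {L : FirstOrder.Language.{u₁, u₂}} [L.IsAlgebraic] {M : Type u} [L.Structure M]

namespace AlterEgo

/-- A homomorphism from `A` to `M`, as a point of the power of the structure on `M`. -/
def homPoint (E : AlterEgo.{u, w} L M) (A : Type u) [L.Structure A] (φ : A →[L] M) :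
    A → E.str := fun a => φ a

theorem isClosed_range_homPoint (E : AlterEgo.{u, w} L M) (A : Type u) [L.Structure A] :
    IsClosed (Set.range (E.homPoint A)) := by
  have : Set.range (E.homPoint A) =
      ⋂ (n : ℕ) (f : L.Functions n) (x : Fin n → A),
        {h : A → E.str | h (Structure.funMap f x) = Structure.funMap f (fun l => h (x l))} := by
    ext h
    simp only [Set.mem_range, Set.mem_iInter, Set.mem_ofPred_eq]
    constructor
    · rintro ⟨φ, rfl⟩ n f x
      exact φ.map_fun f x
    · intro H
      exact ⟨({ toFun := h, map_fun' := fun f x => H _ f x, map_rel' := fun r => isEmptyElim r } :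
        A →[L] M), rfl⟩
  rw [this]
  refine isClosed_iInter fun n => isClosed_iInter fun f => isClosed_iInter fun x => ?_
  refine isClosed_eq (continuous_apply _) ?_
  exact (continuous_of_discreteTopology (α := Fin n → E.str)
    (f := fun y => Structure.funMap f y)).comp (continuous_pi fun l => continuous_apply (x l))

theorem inPrevariety_dual (E : AlterEgo.{u, w} L M) (A : Type u) [L.Structure A] [Nonempty A] :
    InPrevariety E.str (E.dual A) := by
  refine ⟨A, inferInstance, E.homPoint A, ?_⟩
  exact
    { continuous := continuous_induced_dom
      map_op := fun _ _ => rfl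
      map_dom := fun _ _ hx => hx
      map_pop := fun _ _ _ => rfl
      map_rel := fun _ _ hx => hx
      isClosedEmbedding :=
        { eq_induced := rfl
          injective := fun φ ψ h => Hom.ext fun a => congrFun h a
          isClosed_range := E.isClosed_range_homPoint A }
      mem_dom := fun _ _ hx => hx
      mem_rel := fun _ _ hx => hx }

/-- The restriction of a morphism `Z → M` along a morphism `X → Z`, as a homomorphism of dual
algebras. -/
def dualMap (E : AlterEgo.{u, w} L M) {X Z : TopStr.{u} E.τ} (i : X → Z) (hi : IsMor X Z i) :
    Mor Z E.str →[L] Mor X E.str where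
  toFun z := ⟨fun p => z.1 (i p),
    { continuous := z.2.continuous.comp hi.continuous
      map_op := fun g x => by rw [hi.map_op, z.2.map_op]; rfl
      map_dom := fun h x hx => z.2.map_dom h _ (hi.map_dom h x hx)
      map_pop := fun h x hx => by rw [hi.map_pop h x hx, z.2.map_pop]; rfl
      map_rel := fun r x hx => z.2.map_rel r _ (hi.map_rel r x hx) }⟩
  map_fun' _ _ := rfl
  map_rel' r := isEmptyElim r

/-- Under a logarithmic duality, a homomorphism from a product of two algebras to `M` depends on
one coordinate only. -/
theorem YieldsLogarithmicDuality.hom_factors {E : AlterEgo.{u, w} L M}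
    (hE : E.YieldsLogarithmicDuality) {A A₁ A₂ : Type u} [L.Structure A] [L.Structure A₁]
    [L.Structure A₂] (h₁ : InISP L M A₁) (h₂ : InISP L M A₂) (ρ₁ : A →[L] A₁) (ρ₂ : A →[L] A₂)
    (hinj : ∀ a b, ρ₁ a = ρ₁ b → ρ₂ a = ρ₂ b → a = b)
    (hsurj : ∀ a₁ a₂, ∃ a, ρ₁ a = a₁ ∧ ρ₂ a = a₂) (φ : A →[L] M) :
    (∀ a b, ρ₁ a = ρ₁ b → φ a = φ b) ∨ (∀ a b, ρ₂ a = ρ₂ b → φ a = φ b) := by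
  obtain ⟨⟨⟨hdual, hfull⟩, -⟩, hlog⟩ := hE
  have := h₁.1
  have := h₂.1
  obtain ⟨Z, i, j, hc, hu⟩ := hlog _ _ (E.inPrevariety_dual A₁) (E.inPrevariety_dual A₂)
  have hex : ∀ z : Mor Z E.str, ∃ a : A, E.evalAlg A₁ (ρ₁ a) = E.dualMap i hc.mor_left z ∧
      E.evalAlg A₂ (ρ₂ a) = E.dualMap j hc.mor_right z := by
    intro z
    obtain ⟨a₁, ha₁⟩ := (hdual A₁ h₁).2 (E.dualMap i hc.mor_left z)
    obtain ⟨a₂, ha₂⟩ := (hdual A₂ h₂).2 (E.dualMap j hc.mor_right z)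
    obtain ⟨a, rfl, rfl⟩ := hsurj a₁ a₂
    exact ⟨a, ha₁, ha₂⟩
  choose c hc₁ hc₂ using hex
  have huniq : ∀ (z : Mor Z E.str) (a : A), E.evalAlg A₁ (ρ₁ a) = E.dualMap i hc.mor_left z →
      E.evalAlg A₂ (ρ₂ a) = E.dualMap j hc.mor_right z → c z = a := fun z a e₁ e₂ =>
    hinj _ _ ((hdual A₁ h₁).1 ((hc₁ z).trans e₁.symm)) ((hdual A₂ h₂).1 ((hc₂ z).trans e₂.symm))
  -- Transport `φ` to the dual algebra of `Z`, where fullness turns it into evaluation at a point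
  -- `p`.
  let Ψ : Mor Z E.str →[L] M :=
    { toFun := fun z => φ (c z)
      map_fun' := by
        intro n f x
        change φ (c (Structure.funMap f x)) = Structure.funMap f (φ ∘ fun l => c (x l))
        rw [← Hom.map_fun φ f]
        congr 1
        apply huniq
        · rw [Hom.map_fun, Hom.map_fun, Hom.map_fun]
          congr 1
          exact funext fun l => hc₁ (x l)
        · rw [Hom.map_fun, Hom.map_fun, Hom.map_fun]
          congr 1
          exact funext fun l => hc₂ (x l)
      map_rel' := fun r => isEmptyElim r }
  obtain ⟨p, hp⟩ := (hfull Z hc.mem).2 Ψ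
  have hp' : ∀ z : Mor Z E.str, φ (c z) = z.1 p := fun z =>
    (congrArg (fun χ : Mor Z E.str →[L] M => χ z) hp).symm
  -- `c` is onto: the evaluations at the two components of `a` are glued by the universal property
  -- of the coproduct, tested against `M` itself.
  have key : ∀ a : A, ∃ z : Mor Z E.str, c z = a ∧ E.evalAlg A₁ (ρ₁ a) = E.dualMap i hc.mor_left z ∧
      E.evalAlg A₂ (ρ₂ a) = E.dualMap j hc.mor_right z := by
    intro a
    obtain ⟨z, ⟨hz, e₁, e₂⟩, -⟩ := hc.existsUnique E.str E.str.inPrevariety_self _ _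
      (E.evalAlg A₁ (ρ₁ a)).2 (E.evalAlg A₂ (ρ₂ a)).2
    have e₁' : E.evalAlg A₁ (ρ₁ a) = E.dualMap i hc.mor_left ⟨z, hz⟩ :=
      Subtype.ext (funext fun x => (e₁ x).symm)
    have e₂' : E.evalAlg A₂ (ρ₂ a) = E.dualMap j hc.mor_right ⟨z, hz⟩ :=
      Subtype.ext (funext fun x => (e₂ x).symm)
    exact ⟨⟨z, hz⟩, huniq _ _ e₁' e₂', e₁', e₂'⟩
  rcases hu.cover p with ⟨x, rfl⟩ | ⟨y, rfl⟩
  · have hx : ∀ a, φ a = (E.evalAlg A₁ (ρ₁ a)).1 x := by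
      intro a
      obtain ⟨z, rfl, e₁, -⟩ := key a
      rw [hp', e₁]
      rfl
    exact Or.inl fun a b h => by rw [hx, hx, h]
  · have hy : ∀ a, φ a = (E.evalAlg A₂ (ρ₂ a)).1 y := by
      intro a
      obtain ⟨z, rfl, -, e₂⟩ := key a
      rw [hp', e₂]
      rfl
    exact Or.inr fun a b h => by rw [hy, hy, h]

end AlterEgo

theorem InISP.exists_hom_ne {B : Type u} [L.Structure B] (hB : InISP L M B) {b b' : B}
    (h : b ≠ b') : ∃ ψ : B →[L] M, ψ b ≠ ψ b' := by
  obtain ⟨-, S, ⟨k⟩⟩ := hB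
  obtain ⟨s, hs⟩ := Function.ne_iff.1 (k.injective.ne h)
  exact ⟨⟨fun b => k b s, fun f x => congrFun (k.map_fun f x) s, fun r => isEmptyElim r⟩, hs⟩

/-- The evaluation of `A` at a family of homomorphisms to `M`. -/
def evalFamily {A : Type u} [L.Structure A] {S : Type u} (χ : S → A →[L] M) : A →[L] (S → M) where
  toFun a s := χ s a
  map_fun' f x := funext fun s => (χ s).map_fun f x
  map_rel' r := isEmptyElim r

theorem inISP_range_evalFamily {A : Type u} [L.Structure A] [Nonempty A] {S : Type u}
    (χ : S → A →[L] M) : InISP L M (evalFamily χ).range :=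
  ⟨(inferInstance : Nonempty A).map fun a => ⟨evalFamily χ a, a, rfl⟩, S,
    ⟨(evalFamily χ).range.subtype⟩⟩

end Duality

/-! ### Localizing homomorphisms on a Boolean product -/

section BooleanProduct

variable {L : FirstOrder.Language.{u₁, u₂}} {M : Type u} [L.Structure M]
  {I : Type v} {A : Type u} [L.Structure A] {B : I → Type u} [∀ i, L.Structure (B i)]

/-- The projection to a coordinate of a homomorphism to a product. -/
def projHom [L.IsAlgebraic] (f : A ↪[L] (∀ i, B i)) (i : I) : A →[L] B i where
  toFun a := f a i
  map_fun' g x := congrFun (f.map_fun g x) i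
  map_rel' r := isEmptyElim r

/-- The map `φ` only depends on the coordinates in `N`. -/
def DependsOnCoords (f : A ↪[L] (∀ i, B i)) (φ : A →[L] M) (N : Set I) : Prop :=
  ∀ a b, (∀ i ∈ N, f a i = f b i) → φ a = φ b

/-- The elements of `A` can be patched along clopen sets. -/
def HasPatching [TopologicalSpace I] (f : A ↪[L] (∀ i, B i)) : Prop :=
  ∀ (a b : A) (N : Set I), IsClopen N →
    ∃ c : A, (∀ i ∈ N, f c i = f a i) ∧ (∀ i ∉ N, f c i = f b i)

variable {f : A ↪[L] (∀ i, B i)} [TopologicalSpace I]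

/-- The element equal to `a` on `N` and to `b` elsewhere agrees with `a` on `N` and with `b` on `K`.
-/
theorem DependsOnCoords.inter (hpatch : HasPatching f) {φ : A →[L] M} {N K : Set I}
    (hNc : IsClopen N) (hN : DependsOnCoords f φ N) (hK : DependsOnCoords f φ K) :
    DependsOnCoords f φ (N ∩ K) := by
  intro a b hab
  obtain ⟨c, hc₁, hc₂⟩ := hpatch a b N hNc
  refine (hN a c fun i hi => (hc₁ i hi).symm).trans (hK c b fun i hi => ?_)
  by_cases h : i ∈ N
  · exact (hc₁ i h).trans (hab i ⟨h, hi⟩)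
  · exact hc₂ i h

/-- Patching makes `A` the product of its restrictions to `N` and `Nᶜ`. Each restriction is modelled
as the image of `A` under all homomorphisms to `M` depending only on that set, which stays in
universe `u` whatever the universe of `I`. -/
theorem dependsOnCoords_or_compl [L.IsAlgebraic] {E : AlterEgo.{u, w} L M} (hE : E.YieldsLogarithmicDuality)
    (hB : ∀ i, InISP L M (B i)) (hpatch : HasPatching f) [Nonempty A] (φ : A →[L] M) {N : Set I}
    (hN : IsClopen N) : DependsOnCoords f φ N ∨ DependsOnCoords f φ Nᶜ := by
  let χ (K : Set I) : {ψ : A →[L] M // DependsOnCoords f ψ K} → A →[L] M := Subtype.val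
  let ρ (K : Set I) : A →[L] (evalFamily (χ K)).range :=
    { toFun := fun a => ⟨evalFamily (χ K) a, a, rfl⟩
      map_fun' := fun g x => Subtype.ext ((evalFamily (χ K)).map_fun g x)
      map_rel' := fun r => isEmptyElim r }
  have hρ : ∀ K a b, ρ K a = ρ K b ↔ ∀ i ∈ K, f a i = f b i := by
    intro K a b
    constructor
    · intro h i hi
      by_contra hne
      obtain ⟨ψ, hψ⟩ := (hB i).exists_hom_ne hne
      exact hψ (congrFun (congrArg Subtype.val h)
        ⟨ψ.comp (projHom f i), fun a b hab => congrArg ψ (hab i hi)⟩)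
    · exact fun h => Subtype.ext (funext fun ψ => ψ.2 a b h)
  have := hE.hom_factors (inISP_range_evalFamily (χ N)) (inISP_range_evalFamily (χ Nᶜ))
    (ρ N) (ρ Nᶜ) ?_ ?_ φ
  · exact this.imp (fun h a b e => h a b ((hρ _ _ _).2 e)) fun h a b e => h a b ((hρ _ _ _).2 e)
  · intro a b h h'
    refine f.injective (funext fun i => ?_)
    by_cases hi : i ∈ N
    · exact (hρ _ _ _).1 h i hi
    · exact (hρ _ _ _).1 h' i hi
  · rintro ⟨_, a, rfl⟩ ⟨_, b, rfl⟩
    obtain ⟨c, hc₁, hc₂⟩ := hpatch a b N hN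
    exact ⟨c, (hρ N c a).2 hc₁, (hρ Nᶜ c b).2 hc₂⟩

/-- A homomorphism from a Boolean product to `M` is a constant map or factors through one of the
projections. -/
theorem const_or_factors_proj [L.IsAlgebraic] [CompactSpace I] {E : AlterEgo.{u, w} L M}
    (hE : E.YieldsLogarithmicDuality) (hB : ∀ i, InISP L M (B i)) (hpatch : HasPatching f)
    (heq : ∀ a b, IsClopen {i | f a i = f b i}) [Nonempty A] (φ : A →[L] M) :
    (∀ a b, φ a = φ b) ∨ ∃ i, ∀ a b, f a i = f b i → φ a = φ b := by
  by_cases hconst : ∀ a b, φ a = φ b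
  · exact Or.inl hconst
  right
  let F := {N : Set I // IsClopen N ∧ DependsOnCoords f φ N}
  have : Nonempty F := ⟨⟨Set.univ, isClopen_univ,
    fun a b h => congrArg φ (f.injective (funext fun i => h i trivial))⟩⟩
  -- The clopen sets on which `φ` depends are closed under intersection, and none is empty since `φ`
  -- is not constant.
  obtain ⟨i, hi⟩ : (⋂ N : F, N.1).Nonempty := by
    refine IsCompact.nonempty_iInter_of_directed_nonempty_isCompact_isClosed _ ?_ ?_
      (fun N => N.2.1.isClosed.isCompact) (fun N => N.2.1.isClosed)
    · exact fun N K => ⟨⟨N.1 ∩ K.1, N.2.1.inter K.2.1, N.2.2.inter hpatch N.2.1 K.2.2⟩,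
        Set.inter_subset_left, Set.inter_subset_right⟩
    · rintro ⟨N, hN, hNφ⟩
      refine Set.nonempty_iff_ne_empty.2 ?_
      rintro rfl
      exact hconst fun a b => hNφ a b fun _ h => h.elim
  refine ⟨i, fun a b hab => ?_⟩
  -- Apply the dichotomy to the equalizer of `a` and `b`: it contains `i`, so `φ` cannot depend only
  -- on its complement.
  rcases dependsOnCoords_or_compl hE hB hpatch φ (heq a b) with h | h
  · exact h a b fun _ hj => hj
  · exact absurd hab (Set.mem_iInter.1 hi ⟨_, (heq a b).compl, h⟩)

variable [CompactSpace I] [T2Space I] [TotallyDisconnectedSpace I]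

/-- Separate `i` from `j` by a clopen set and patch: some element agrees with `a` at `i` and with
`b` at `j`. -/
theorem const_of_factors_two_proj (hpatch : HasPatching f) {φ : A →[L] M} {i j : I} (hij : i ≠ j)
    (hi : ∀ a b, f a i = f b i → φ a = φ b) (hj : ∀ a b, f a j = f b j → φ a = φ b) (a b : A) :
    φ a = φ b := by
  obtain ⟨N, hN, hiN, hjN⟩ := compact_exists_isClopen_in_isOpen
    (isOpen_compl_singleton (x := j)) hij
  obtain ⟨c, hc₁, hc₂⟩ := hpatch a b N hN
  exact (hi a c (hc₁ i hiN).symm).trans (hj c b (hc₂ j fun h => hjN h rfl))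

theorem exists_interpolation (hpatch : HasPatching f) [Nonempty A] (a : I → A) (J : Finset I) :
    ∃ c, ∀ i ∈ J, f c i = f (a i) i := by
  classical
  induction J using Finset.induction_on with
  | empty => exact ⟨Classical.arbitrary A, by simp⟩
  | insert j J hj ih =>
    obtain ⟨c, hc⟩ := ih
    obtain ⟨N, hN, hjN, hNJ⟩ := compact_exists_isClopen_in_isOpen
      (J.finite_toSet.isClosed.isOpen_compl) (x := j) (by simpa using hj)
    obtain ⟨d, hd₁, hd₂⟩ := hpatch (a j) c N hN
    refine ⟨d, fun i hi => ?_⟩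
    rcases Finset.mem_insert.1 hi with rfl | hi
    · exact hd₁ i hjN
    · rw [hd₂ i fun h => hNJ h hi, hc i hi]

end BooleanProduct

/-! ### Natural extensions by finite approximation -/

section NaturalExtension

variable {L : FirstOrder.Language.{u₁, u₂}} {M : Type u} [L.Structure M]
  [TopologicalSpace M] [DiscreteTopology M]

/-- As `M` is discrete, prescribing finitely many coordinates gives a neighbourhood base. -/
theorem mem_natExt_iff {A : Type u} [L.Structure A] {y : (A →[L] M) → M} :
    y ∈ natExt L M A ↔ ∀ F : Finset (A →[L] M), ∃ a : A, ∀ φ ∈ F, φ a = y φ := by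
  change y ∈ closure (Set.range fun (a : A) (φ : A →[L] M) => φ a) ↔ _
  rw [mem_closure_iff]
  constructor
  · intro h F
    obtain ⟨_, hz, a, rfl⟩ := h ((F : Set (A →[L] M)).pi fun φ => {y φ})
      (isOpen_set_pi F.finite_toSet fun _ _ => isOpen_discrete _) fun _ _ => rfl
    exact ⟨a, hz⟩
  · intro h U hU hyU
    obtain ⟨F, u, hu, hFU⟩ := isOpen_pi_iff.1 hU y hyU
    obtain ⟨a, ha⟩ := h F
    refine ⟨_, hFU fun φ hφ => ?_, a, rfl⟩
    change φ a ∈ u φ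
    exact (ha φ hφ).symm ▸ (hu φ hφ).2

theorem natExt_apply_of_const {A : Type u} [L.Structure A] {y : (A →[L] M) → M}
    (hy : y ∈ natExt L M A) {φ : A →[L] M} (hφ : ∀ a b, φ a = φ b) (a : A) : y φ = φ a := by
  obtain ⟨b, hb⟩ := mem_natExt_iff.1 hy {φ}
  rw [← hb φ (Finset.mem_singleton_self φ), hφ]

variable [L.IsAlgebraic]

/-- The homomorphism of natural extensions induced by a homomorphism of algebras. -/
def natExtMap {A A' : Type u} [L.Structure A] [L.Structure A'] (ρ : A →[L] A') :
    natExt L M A →[L] natExt L M A' where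
  toFun y := ⟨fun ψ => y.1 (ψ.comp ρ), mem_natExt_iff.2 fun F => by
    classical
    obtain ⟨a, ha⟩ := mem_natExt_iff.1 y.2 (F.image fun ψ => ψ.comp ρ)
    exact ⟨ρ a, fun ψ hψ => ha _ (Finset.mem_image_of_mem _ hψ)⟩⟩
  map_fun' _ _ := rfl
  map_rel' r := isEmptyElim r

theorem continuous_natExtMap {A A' : Type u} [L.Structure A] [L.Structure A'] (ρ : A →[L] A') :
    Continuous (natExtMap (M := M) ρ) :=
  Continuous.subtype_mk (continuous_pi fun ψ =>
    (continuous_apply (ψ.comp ρ)).comp continuous_subtype_val) _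

end NaturalExtension

end NatExt

/-! ### The comparison map is a homeomorphic isomorphism -/

theorem mainTheorem4 {L : FirstOrder.Language.{u₁, u₂}} [L.IsAlgebraic]
    (hfin : Finite (Σ n, L.Functions n))
    {M : Type u} [L.Structure M] [Finite M] [Nonempty M]
    [TopologicalSpace M] [DiscreteTopology M]
    (E : NatExt.AlterEgo.{u, w} L M) (hE : E.YieldsLogarithmicDuality)
    {I : Type v} (B : I → Type u) [∀ i, L.Structure (B i)] (hB : ∀ i, NatExt.InISP L M (B i))
    (A : Type u) [L.Structure A] [Nonempty A] (hA : NatExt.IsBooleanProduct L A B)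
    (hopen : ∀ n : ℕ, 0 < n → ∀ m : Fin n → M, ∃ φ : L.Formula (Fin n), φ.IsQF ∧
      ∀ (i : I) (a : Fin n → B i),
        (⋃ l, NatExt.bracket (L := L) (a l) (m l)) = Set.univ ↔ φ.Realize a) :
    ∃ e : NatExt.natExt L M A ≃[L] (∀ i, NatExt.natExt L M (B i)), IsHomeomorph e := by
  classical
  obtain ⟨_, f, _, _, _, hsurj, heq, hpatch⟩ := hA
  let ρ := NatExt.projHom f
  have hfac : ∀ φ : A →[L] M, (∀ a b, φ a = φ b) ∨
      ∃ (i : I) (ψ : B i →[L] M), ψ.comp (ρ i) = φ := by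
    intro φ
    refine (NatExt.const_or_factors_proj hE hB hpatch heq φ).imp_right ?_
    rintro ⟨i, hi⟩
    -- The section of the projection need not be a homomorphism, but `φ` does not see the choice of
    -- preimage.
    have hs : ∀ a, φ (Function.surjInv (hsurj i) (f a i)) = φ a := fun a =>
      hi _ _ (Function.surjInv_eq (hsurj i) (f a i))
    refine ⟨i, ⟨fun b => φ (Function.surjInv (hsurj i) b), fun {n} g x => ?_,
      fun r => isEmptyElim r⟩, FirstOrder.Language.Hom.ext hs⟩
    obtain ⟨y, rfl⟩ : ∃ y : Fin n → A, (ρ i) ∘ y = x :=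
      ⟨fun l => Function.surjInv (hsurj i) (x l),
        funext fun l => Function.surjInv_eq (hsurj i) (x l)⟩
    rw [← (ρ i).map_fun]
    refine (hs _).trans ((φ.map_fun g y).trans ?_)
    congr 1
    exact funext fun l => (hs (y l)).symm
  let r : NatExt.natExt L M A →[L] (∀ i, NatExt.natExt L M (B i)) :=
    { toFun := fun y i => NatExt.natExtMap (ρ i) y
      map_fun' := fun _ _ => rfl
      map_rel' := fun r => isEmptyElim r }
  have hcont : Continuous r := continuous_pi fun i => NatExt.continuous_natExtMap (ρ i)
  have hbij : Function.Bijective r := by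
    constructor
    · intro y y' h
      refine Subtype.ext (funext fun φ => ?_)
      rcases hfac φ with hφ | ⟨i, ψ, rfl⟩
      · have a := Classical.arbitrary A
        rw [NatExt.natExt_apply_of_const y.2 hφ a, NatExt.natExt_apply_of_const y'.2 hφ a]
      · exact congrFun (congrArg Subtype.val (congrFun h i)) ψ
    · intro x
      -- The preimage `y` of `x` must take the value `m` at `φ`. Constants are prescribed
      -- separately: they may factor through several projections, or through none if `I` is empty.
      have hval : ∀ φ : A →[L] M, ∃ m : M, ((∀ a b, φ a = φ b) → ∀ a, φ a = m) ∧
          ∀ (i : I) (ψ : B i →[L] M), ψ.comp (ρ i) = φ → (x i).1 ψ = m := by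
        intro φ
        by_cases hφ : ∀ a b, φ a = φ b
        · refine ⟨φ (Classical.arbitrary A), fun h a => h _ _, ?_⟩
          rintro i ψ rfl
          refine NatExt.natExt_apply_of_const (x i).2 (fun b b' => ?_) _
          obtain ⟨a, rfl⟩ := hsurj i b
          obtain ⟨a', rfl⟩ := hsurj i b'
          exact hφ a a'
        · obtain ⟨i, ψ, rfl⟩ := (hfac φ).resolve_left hφ
          refine ⟨(x i).1 ψ, fun h => absurd h hφ, fun j χ h => ?_⟩
          have hχ : ∀ a, χ (f a j) = ψ (f a i) := fun a => DFunLike.congr_fun h a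
          obtain rfl : i = j := by
            by_contra hij
            refine hφ (NatExt.const_of_factors_two_proj hpatch hij (fun a b e => ?_)
              fun a b e => ?_)
            · exact congrArg ψ e
            · exact (hχ a).symm.trans ((congrArg χ e).trans (hχ b))
          refine congrArg (x i).1 (FirstOrder.Language.Hom.ext fun b => ?_)
          obtain ⟨a, rfl⟩ := hsurj i b
          exact hχ a
      choose y hyc hy using hval
      have hmem : y ∈ NatExt.natExt L M A := by
        refine NatExt.mem_natExt_iff.2 fun F => ?_
        -- Attach at most one index to each `φ`, so that a finite `F` involves only finitely many
        -- indices.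
        have hidx : ∀ φ : A →[L] M, ∃ J : Finset I, (∀ a b, φ a = φ b) ∨
            ∃ i ∈ J, ∃ ψ : B i →[L] M, ψ.comp (ρ i) = φ := fun φ =>
          (hfac φ).elim (fun h => ⟨∅, Or.inl h⟩)
            fun ⟨i, h⟩ => ⟨{i}, Or.inr ⟨i, Finset.mem_singleton_self i, h⟩⟩
        choose J hJ using hidx
        have hloc : ∀ i, ∃ a : A, ∀ ψ : B i →[L] M, ψ.comp (ρ i) ∈ F → ψ (f a i) = (x i).1 ψ := by
          intro i
          -- The preimage of `F` is finite because composing with the onto map `ρ i` is injective.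
          obtain ⟨b, hb⟩ := NatExt.mem_natExt_iff.1 (x i).2 (F.preimage (fun ψ => ψ.comp (ρ i))
            (Function.Injective.injOn fun ψ χ h => FirstOrder.Language.Hom.ext fun b => by
              obtain ⟨a, rfl⟩ := hsurj i b
              exact DFunLike.congr_fun h a))
          obtain ⟨a, rfl⟩ := hsurj i b
          exact ⟨a, fun ψ hψ => hb ψ (Finset.mem_preimage.2 hψ)⟩
        choose a ha using hloc
        obtain ⟨c, hc⟩ := NatExt.exists_interpolation hpatch a (F.biUnion J)
        refine ⟨c, fun φ hφ => ?_⟩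
        rcases hJ φ with h | ⟨i, hi, ψ, rfl⟩
        · exact hyc φ h c
        · rw [← hy _ i ψ rfl, ← ha i ψ hφ, ← hc i (Finset.mem_biUnion.2 ⟨_, hφ, hi⟩)]
          rfl
      exact ⟨⟨y, hmem⟩, funext fun i => Subtype.ext (funext fun ψ => (hy _ i ψ rfl).symm)⟩
  have : CompactSpace (NatExt.natExt L M A) :=
    isCompact_iff_compactSpace.1 (isClosed_closure.isCompact)
  refine ⟨⟨Equiv.ofBijective r hbij, r.map_fun', fun r => isEmptyElim r⟩, ?_⟩
  -- A continuous bijection from a compact space to a Hausdorff one.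
  exact isHomeomorph_iff_continuous_bijective.2 ⟨hcont, hbij⟩
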